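/- Let $p$ be a prime, let $S'\le S$ be finite $p$-groups, let $\mathcal F_1$ be a saturated fusion system over $S$, and let $\mathcal F_2,\mathcal F_e$ be saturated fusion systems over $S'$ with $\mathcal F_e\subseteq\mathcal F_1$ and $\mathcal F_e\subseteq\mathcal F_2$. Let $\mathcal F=\langle\mathcal F_1,\mathcal F_2\rangle_S$ be the smallest fusion system over $S$ containing $\mathcal F_1$ and $\mathcal F_2$, and assume that $\mathcal F$ is saturated. Let $\mathcal C$ be a family of $\mathcal F$-centric subgroups of $S$ that is closed under $\mathcal F$-conjugacy and under taking overgroups in $S$, and let $Q\le S'$ be a fully $\mathcal F$-normalized subgroup belonging to $\mathcal C$. For a fusion system $\mathcal E$ over a subgroup $T\le S$ let $\mathcal O_{\mathcal C}(\mathcal E)$ be the category whose objects are the subgroups of $T$ belonging to $\mathcal C$ and whose morphisms are $\operatorname{Hom}(P,R)=\operatorname{Aut}_R(R)\backslash\operatorname{Hom}_{\mathcal E}(P,R)$. For $\mathcal H\subseteq\mathcal E$ let $\uparrow_{\mathcal H}^{\mathcal E}$ denote induction (left Kan extension, i.e. tensor product over the category algebra) of functors $\mathcal O_{\mathcal C}(\mathcal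 H)^{\mathrm{op}}\to\mathbb F_p\text{-Mod}$ to functors $\mathcal O_{\mathcal C}(\mathcal E)^{\mathrm{op}}\to\mathbb F_p\text{-Mod}$, and let $\underline{\mathbb F_p}$ denote the constant functor. Put $\mathcal G_x=N_{\mathcal F_x}(Q)$ for $x\in\{1,2,e\}$, $\mathcal G=\langle\mathcal G_1,\mathcal G_2\rangle_{N_S(Q)}$, $$CX_1=\underline{\mathbb F_p}\uparrow_{\mathcal F_e}^{\mathcal F},\qquad CY_1=\underline{\mathbb F_p}\uparrow_{\mathcal G_e}^{\mathcal G},$$ let $\pi_1:CY_1\uparrow_{\mathcal G}^{\mathcal F}\to CX_1$ be the natural projection $\lambda\otimes\varphi\mapsto\lambda\otimes\varphi$ arising from the inclusion $\mathcal G_e\subseteq\mathcal F_e$, and for a functor $M:\mathcal O_{\mathcal C}(\mathcal F)^{\mathrm{op}}\to\mathbb F_p\text{-Mod}$ let $$\pi_1^*:\operatorname{Nat}(CX_1,M)\to\operatorname{Nat}(CY_1\uparrow_{\mathcal G}^{\mathcal F},M)$$ be precomposition with $\pi_1$. Suppose that $\mathcal F_e$ is realizable, i.e. there is a finite group $K$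 having $S'$ as a Sylow $p$-subgroup such that the morphisms of $\mathcal F_e$ are exactly the homomorphisms between subgroups of $S'$ given by conjugation by elements of $K$. Suppose moreover that $Q\trianglelefteq S'$ and that $M=H^j(-;\mathbb F_p)$ for some $j\ge0$. Then $\pi_1^*$ is a split monomorphism of $\mathbb F_p$-modules: there is an $\mathbb F_p$-linear map $\xi$ with $\xi\circ\pi_1^*=\operatorname{id}$. -/

import Mathlib

open CategoryTheory

noncomputable section

/-! ### Fusion systems

All groups in sight are subgroups of one ambient group `S`; a fusion system over `T ≤ S` has the
subgroups of `T` as objects. -/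

/-- A fusion system over the subgroup `T` of `S`. The set `hom P Q` consists of the morphisms from
`P` to `Q`; it is empty unless `P` and `Q` are subgroups of `T`. -/
structure FusionSystem {S : Type} [Group S] (T : Subgroup S) where
  hom : ∀ P Q : Subgroup S, Set (P →* Q)
  le_of_mem : ∀ {P Q : Subgroup S} {φ : P →* Q}, φ ∈ hom P Q → P ≤ T ∧ Q ≤ T
  injective_of_mem : ∀ {P Q : Subgroup S} {φ : P →* Q}, φ ∈ hom P Q → Function.Injective φ
  comp_mem : ∀ {P Q R : Subgroup S} {φ : P →* Q} {ψ : Q →* R},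
    φ ∈ hom P Q → ψ ∈ hom Q R → ψ.comp φ ∈ hom P R
  /-- Conjugations by elements of `T` (in particular identities and inclusions) are morphisms. -/
  conj_mem : ∀ {P Q : Subgroup S} (φ : P →* Q), P ≤ T → Q ≤ T →
    ∀ t ∈ T, (∀ x : P, (φ x : S) = t * x * t⁻¹) → φ ∈ hom P Q
  /-- Inverses of morphisms that are group isomorphisms are morphisms. -/
  symm_mem : ∀ {P Q : Subgroup S} (e : P ≃* Q),
    e.toMonoidHom ∈ hom P Q → e.symm.toMonoidHom ∈ hom Q P
  /-- Restricting a morphism to its image `R` gives a morphism. -/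
  restrict_mem : ∀ {P Q R : Subgroup S} {φ : P →* Q} (ψ : P →* R), φ ∈ hom P Q →
    (∀ x : P, (ψ x : S) = φ x) → Function.Surjective ψ → ψ ∈ hom P R

namespace FusionSystem

variable {S : Type} [Group S] {T T' U : Subgroup S}

/-- `F.Sub E` means `F ⊆ E`: every morphism of `F` is a morphism of `E`. -/
def Sub (F : FusionSystem T) (E : FusionSystem U) : Prop :=
  ∀ P Q : Subgroup S, F.hom P Q ⊆ E.hom P Q

lemma Sub.trans {F : FusionSystem T} {E : FusionSystem T'} {D : FusionSystem U}
    (h : F.Sub E) (h' : E.Sub D) : F.Sub D := fun P Q _ hφ => h' P Q (h P Q hφ)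

lemma inclusion_mem (F : FusionSystem T) {P Q : Subgroup S} (h : P ≤ Q) (hQ : Q ≤ T) :
    Subgroup.inclusion h ∈ F.hom P Q :=
  F.conj_mem _ (h.trans hQ) hQ 1 T.one_mem (by simp)

lemma id_mem (F : FusionSystem T) {P : Subgroup S} (h : P ≤ T) : MonoidHom.id P ∈ F.hom P P :=
  F.conj_mem _ h h 1 T.one_mem (by simp)

lemma Sub.le {F : FusionSystem T} {E : FusionSystem U} (h : F.Sub E) : T ≤ U :=
  (E.le_of_mem (h T T (F.id_mem le_rfl))).1

lemma cod_mem (F : FusionSystem T) {P Q R : Subgroup S} {φ : P →* Q} (ψ : P →* R)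
    (hφ : φ ∈ F.hom P Q) (hR : R ≤ T) (h : ∀ x : P, (ψ x : S) = φ x) : ψ ∈ F.hom P R := by
  let I : Subgroup S := (R.subtype.comp ψ).range
  have hI : I ≤ R := by rintro _ ⟨x, rfl⟩; exact (ψ x).2
  have h1 : (R.subtype.comp ψ).rangeRestrict ∈ F.hom P I :=
    F.restrict_mem _ hφ h (MonoidHom.rangeRestrict_surjective _)
  exact F.comp_mem h1 (F.inclusion_mem hI hR)

/-- The fusion system over `T` of all injective homomorphisms between subgroups of `T`. -/
def full (T : Subgroup S) : FusionSystem T where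
  hom P Q := {φ | P ≤ T ∧ Q ≤ T ∧ Function.Injective φ}
  le_of_mem h := ⟨h.1, h.2.1⟩
  injective_of_mem h := h.2.2
  comp_mem h h' := ⟨h.1, h'.2.1, h'.2.2.comp h.2.2⟩
  conj_mem φ hP hQ t _ h := by
    refine ⟨hP, hQ, fun x y hxy => ?_⟩
    have : (φ x : S) = φ y := congrArg _ hxy
    rw [h, h] at this
    exact Subtype.ext (by simpa using this)
  symm_mem e h := ⟨h.2.1, h.1, e.symm.injective⟩
  restrict_mem {P Q R φ} ψ h h' hs := by
    refine ⟨h.1, ?_, fun x y hxy => h.2.2 (Subtype.ext ?_)⟩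
    · intro r hr
      obtain ⟨x, hx⟩ := hs ⟨r, hr⟩
      have := h' x
      rw [hx] at this
      have h2 := h.2.1 (φ x).2
      rwa [← this] at h2
    · rw [← h', ← h', hxy]

/-- `⟨F₁, F₂⟩_T`: the smallest fusion system over `T` containing the fusion systems `F₁` over `T`
and `F₂` over `T' ≤ T`. -/
def gen (F₁ : FusionSystem T) (F₂ : FusionSystem T') (hT : T' ≤ T) : FusionSystem T where
  hom P Q := {φ | ∀ E : FusionSystem T, F₁.Sub E → F₂.Sub E → φ ∈ E.hom P Q}
  le_of_mem h := (full T).le_of_mem (h (full T)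
    (fun _ _ _ hφ => ⟨(F₁.le_of_mem hφ).1, (F₁.le_of_mem hφ).2, F₁.injective_of_mem hφ⟩)
    (fun _ _ _ hφ => ⟨(F₂.le_of_mem hφ).1.trans hT, (F₂.le_of_mem hφ).2.trans hT,
      F₂.injective_of_mem hφ⟩))
  injective_of_mem h := (full T).injective_of_mem (h (full T)
    (fun _ _ _ hφ => ⟨(F₁.le_of_mem hφ).1, (F₁.le_of_mem hφ).2, F₁.injective_of_mem hφ⟩)
    (fun _ _ _ hφ => ⟨(F₂.le_of_mem hφ).1.trans hT, (F₂.le_of_mem hφ).2.trans hT,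
      F₂.injective_of_mem hφ⟩))
  comp_mem h h' E h₁ h₂ := E.comp_mem (h E h₁ h₂) (h' E h₁ h₂)
  conj_mem φ hP hQ t ht h E _ _ := E.conj_mem φ hP hQ t ht h
  symm_mem e h E h₁ h₂ := E.symm_mem e (h E h₁ h₂)
  restrict_mem ψ h h' hs E h₁ h₂ := E.restrict_mem ψ (h E h₁ h₂) h' hs

lemma sub_gen_left (F₁ : FusionSystem T) (F₂ : FusionSystem T') (hT : T' ≤ T) :
    F₁.Sub (F₁.gen F₂ hT) := fun P Q _ hφ _ h₁ _ => h₁ P Q hφ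

lemma sub_gen_right (F₁ : FusionSystem T) (F₂ : FusionSystem T') (hT : T' ≤ T) :
    F₂.Sub (F₁.gen F₂ hT) := fun P Q _ hφ _ _ h₂ => h₂ P Q hφ

lemma gen_sub (F₁ : FusionSystem T) (F₂ : FusionSystem T') (hT : T' ≤ T) (E : FusionSystem T)
    (h₁ : F₁.Sub E) (h₂ : F₂.Sub E) : (F₁.gen F₂ hT).Sub E := fun _ _ _ hφ => hφ E h₁ h₂

/-- The defining condition for morphisms of the normalizer `N_F(Q)`: the morphism `φ : A → B`
extends to a morphism `ψ : AQ → BQ` with `ψ(Q) = Q`. -/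
def ExtendsNormalizing (F : FusionSystem T) (Q : Subgroup S) {A B : Subgroup S} (φ : A →* B) :
    Prop :=
  ∃ ψ ∈ F.hom (A ⊔ Q) (B ⊔ Q),
    (Q.subgroupOf (A ⊔ Q)).map ((B ⊔ Q).subtype.comp ψ) = Q ∧
      ∀ (x : A) (y : ↥(A ⊔ Q)), (y : S) = x → (ψ y : S) = φ x

lemma map_subgroupOf_eq_iff {A B Q : Subgroup S} (ψ : A →* B) :
    (Q.subgroupOf A).map (B.subtype.comp ψ) = Q ↔
      (∀ y : A, (y : S) ∈ Q → (ψ y : S) ∈ Q) ∧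
        ∀ q ∈ Q, ∃ y : A, (y : S) ∈ Q ∧ (ψ y : S) = q := by
  constructor
  · intro h
    refine ⟨fun y hy => ?_, fun q hq => ?_⟩
    · have : (B.subtype.comp ψ) y ∈ (Q.subgroupOf A).map (B.subtype.comp ψ) :=
        Subgroup.mem_map_of_mem _ (Subgroup.mem_subgroupOf.2 hy)
      rwa [h] at this
    · rw [← h] at hq
      obtain ⟨y, hy, hyq⟩ := hq
      exact ⟨y, Subgroup.mem_subgroupOf.1 hy, hyq⟩
  · rintro ⟨h1, h2⟩
    ext q
    constructor
    · rintro ⟨y, hy, rfl⟩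
      exact h1 y (Subgroup.mem_subgroupOf.1 hy)
    · intro hq
      obtain ⟨y, hy, rfl⟩ := h2 q hq
      exact ⟨y, Subgroup.mem_subgroupOf.2 hy, rfl⟩

/-- The normalizer `N_F(Q)` of `Q ≤ T` in `F`, a fusion system over `N_T(Q)`. -/
def normalizer (F : FusionSystem T) (Q : Subgroup S) (hQ : Q ≤ T) :
    FusionSystem (T ⊓ Subgroup.normalizer (Q : Set S)) where
  hom A B := {φ | A ≤ T ⊓ Subgroup.normalizer (Q : Set S) ∧
    B ≤ T ⊓ Subgroup.normalizer (Q : Set S) ∧ φ ∈ F.hom A B ∧ F.ExtendsNormalizing Q φ}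
  le_of_mem h := ⟨h.1, h.2.1⟩
  injective_of_mem h := F.injective_of_mem h.2.2.1
  comp_mem := by
    rintro P R U φ φ' ⟨hP, hR, hφ, ψ, hψ, hψQ, hψe⟩ ⟨-, hU, hφ', ψ', hψ', hψQ', hψe'⟩
    refine ⟨hP, hU, F.comp_mem hφ hφ', ψ'.comp ψ, F.comp_mem hψ hψ', ?_, ?_⟩
    · rw [map_subgroupOf_eq_iff] at hψQ hψQ' ⊢
      refine ⟨fun y hy => hψQ'.1 _ (hψQ.1 y hy), fun q hq => ?_⟩
      obtain ⟨z, hz, rfl⟩ := hψQ'.2 q hq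
      obtain ⟨y, hy, hyz⟩ := hψQ.2 z hz
      exact ⟨y, hy, by rw [MonoidHom.comp_apply, Subtype.ext hyz]⟩
    · intro x y hxy
      exact hψe' (φ x) (ψ y) (hψe x y hxy)
  conj_mem := by
    intro P R φ hP hR t ht h
    have hN : ∀ q, q ∈ Q ↔ t * q * t⁻¹ ∈ Q := Subgroup.mem_set_normalizer_iff.1 ht.2
    have key : P ⊔ Q ≤ (R ⊔ Q).comap (MulAut.conj t).toMonoidHom := by
      refine sup_le (fun x hx => ?_) (fun x hx => ?_)
      · have := (φ ⟨x, hx⟩).2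
        rw [h] at this
        exact (le_sup_left : R ≤ R ⊔ Q) this
      · exact (le_sup_right : Q ≤ R ⊔ Q) ((hN x).1 hx)
    refine ⟨hP, hR, F.conj_mem φ (hP.trans inf_le_left) (hR.trans inf_le_left) t ht.1 h,
      ((MulAut.conj t).toMonoidHom.comp (P ⊔ Q).subtype).codRestrict (R ⊔ Q)
        (fun x => key x.2), ?_, ?_, ?_⟩
    · exact F.conj_mem _ (sup_le (hP.trans inf_le_left) hQ) (sup_le (hR.trans inf_le_left) hQ)
        t ht.1 (fun x => rfl)
    · rw [map_subgroupOf_eq_iff]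
      refine ⟨fun y hy => (hN y).1 hy, fun q hq => ?_⟩
      have hq' : t⁻¹ * q * t ∈ Q := by
        rw [hN]
        simpa [mul_assoc] using hq
      refine ⟨⟨t⁻¹ * q * t, (le_sup_right : Q ≤ P ⊔ Q) hq'⟩, hq', ?_⟩
      change t * (t⁻¹ * q * t) * t⁻¹ = q
      group
    · intro x y hxy
      rw [h, ← hxy]
      rfl
  symm_mem := by
    rintro P R e ⟨hP, hR, he, ψ, hψ, hψQ, hψe⟩
    rw [map_subgroupOf_eq_iff] at hψQ
    have hsurj : Function.Surjective ψ := by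
      have h1 : R ⊔ Q ≤ ((R ⊔ Q).subtype.comp ψ).range := by
        refine sup_le (fun r hr => ?_) (fun q hq => ?_)
        · let x := e.symm ⟨r, hr⟩
          refine ⟨⟨x, (le_sup_left : P ≤ P ⊔ Q) x.2⟩, ?_⟩
          have := hψe x ⟨x, (le_sup_left : P ≤ P ⊔ Q) x.2⟩ rfl
          simpa [x] using this
        · obtain ⟨y, -, hy⟩ := hψQ.2 q hq
          exact ⟨y, hy⟩
      intro z
      obtain ⟨y, hy⟩ := h1 z.2
      exact ⟨y, Subtype.ext hy⟩
    let ε : ↥(P ⊔ Q) ≃* ↥(R ⊔ Q) := MulEquiv.ofBijective ψ ⟨F.injective_of_mem hψ, hsurj⟩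
    have hε : ε.toMonoidHom = ψ := rfl
    have hεa : ∀ y, ε y = ψ y := fun _ => rfl
    refine ⟨hR, hP, F.symm_mem e he, ε.symm.toMonoidHom, F.symm_mem ε (by rw [hε]; exact hψ), ?_, ?_⟩
    · rw [map_subgroupOf_eq_iff]
      refine ⟨fun z hz => ?_, fun q hq => ?_⟩
      · obtain ⟨y, hy, hyz⟩ := hψQ.2 z hz
        have : z = ε y := Subtype.ext hyz.symm
        subst this
        simpa using hy
      · refine ⟨ε ⟨q, (le_sup_right : Q ≤ P ⊔ Q) hq⟩, hψQ.1 _ hq, ?_⟩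
        simp
    · intro x z hxz
      have h1 := hψe (e.symm x) ⟨e.symm x, (le_sup_left : P ≤ P ⊔ Q) (e.symm x).2⟩ rfl
      have h2 : ε ⟨e.symm x, (le_sup_left : P ≤ P ⊔ Q) (e.symm x).2⟩ = z := by
        apply Subtype.ext
        rw [hεa, h1, hxz]
        simp
      rw [← h2]
      simp
  restrict_mem := by
    rintro P R U φ φ' ⟨hP, hR, hφ, ψ, hψ, hψQ, hψe⟩ h hs
    rw [map_subgroupOf_eq_iff] at hψQ
    have hφ' : φ' ∈ F.hom P U := F.restrict_mem φ' hφ h hs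
    have hUR : U ≤ R := fun u hu => by
      obtain ⟨x, hx⟩ := hs ⟨u, hu⟩
      have h1 := h x
      rw [hx] at h1
      have h2 := (φ x).2
      rwa [← h1] at h2
    have key : P ⊔ Q ≤ ((U ⊔ Q).comap ((R ⊔ Q).subtype.comp ψ)).map (P ⊔ Q).subtype := by
      refine sup_le (fun x hx => ?_) (fun x hx => ?_)
      · refine ⟨⟨x, (le_sup_left : P ≤ P ⊔ Q) hx⟩, ?_, rfl⟩
        have h1 := hψe ⟨x, hx⟩ ⟨x, (le_sup_left : P ≤ P ⊔ Q) hx⟩ rfl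
        rw [← h] at h1
        have h2 := (φ' ⟨x, hx⟩).2
        rw [← h1] at h2
        exact (le_sup_left : U ≤ U ⊔ Q) h2
      · refine ⟨⟨x, (le_sup_right : Q ≤ P ⊔ Q) hx⟩, ?_, rfl⟩
        exact (le_sup_right : Q ≤ U ⊔ Q) (hψQ.1 _ hx)
    have key' : ∀ y : ↥(P ⊔ Q), (ψ y : S) ∈ U ⊔ Q := fun y => by
      obtain ⟨z, hz, hzy⟩ := key y.2
      rw [← Subtype.ext hzy]
      exact hz
    refine ⟨hP, hUR.trans hR, hφ', ((R ⊔ Q).subtype.comp ψ).codRestrict (U ⊔ Q) key',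
      F.cod_mem _ hψ (sup_le (F.le_of_mem hφ').2 hQ) (fun x => rfl), ?_, ?_⟩
    · rw [map_subgroupOf_eq_iff]
      exact ⟨fun y hy => hψQ.1 y hy, fun q hq => hψQ.2 q hq⟩
    · intro x y hxy
      rw [h]
      exact hψe x y hxy

lemma normalizer_sub (F : FusionSystem T) (Q : Subgroup S) (hQ : Q ≤ T) :
    (F.normalizer Q hQ).Sub F := fun _ _ _ h => h.2.2.1

lemma Sub.normalizer {F : FusionSystem T} {E : FusionSystem U} (h : F.Sub E) {Q : Subgroup S}
    (hQ : Q ≤ T) (hQ' : Q ≤ U) : (F.normalizer Q hQ).Sub (E.normalizer Q hQ') := by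
  rintro A B φ ⟨hA, hB, hφ, ψ, hψ, h1, h2⟩
  have hN := inf_le_inf_right (Subgroup.normalizer (Q : Set S)) h.le
  exact ⟨hA.trans hN, hB.trans hN, h _ _ hφ, ψ, h _ _ hψ, h1, h2⟩

/-! ### Conjugacy, centric and fully normalized subgroups, saturation, realizability -/

/-- `P` and `Q` are isomorphic in `F`. -/
def IsConj (F : FusionSystem T) (P Q : Subgroup S) : Prop :=
  ∃ e : P ≃* Q, e.toMonoidHom ∈ F.hom P Q

/-- `P ≤ T` is fully `F`-normalized: `|N_T(P)| ≥ |N_T(Q)|` for all `F`-conjugates `Q` of `P`. -/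
def IsFullyNormalized (F : FusionSystem T) (P : Subgroup S) : Prop :=
  P ≤ T ∧ ∀ Q, F.IsConj P Q →
    Nat.card ↥(T ⊓ Subgroup.normalizer (Q : Set S)) ≤
      Nat.card ↥(T ⊓ Subgroup.normalizer (P : Set S))

/-- `P ≤ T` is `F`-centric: `C_T(Q) ≤ Q` for all `F`-conjugates `Q` of `P`. -/
def IsCentric (F : FusionSystem T) (P : Subgroup S) : Prop :=
  P ≤ T ∧ ∀ Q, F.IsConj P Q → T ⊓ Subgroup.centralizer (Q : Set S) ≤ Q

/-- The group `Aut_F(T)` of `F`-automorphisms of `T`. -/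
def autTop (F : FusionSystem T) : Subgroup (MulAut T) where
  carrier := {e | e.toMonoidHom ∈ F.hom T T}
  one_mem' := F.id_mem le_rfl
  mul_mem' {a b} ha hb := F.comp_mem (φ := b.toMonoidHom) (ψ := a.toMonoidHom) hb ha
  inv_mem' {a} ha := F.symm_mem a ha

/-- The image of a homomorphism between subgroups of `S`, as a subgroup of `S`. -/
def image {P Q : Subgroup S} (φ : P →* Q) : Subgroup S := (Q.subtype.comp φ).range

/-- For `φ : P → Q`, the subgroup `N_φ` of all `y ∈ N_T(P)` for which there is `z ∈ N_T(φ(P))`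
such that `φ (y a y⁻¹) = z φ(a) z⁻¹` for all `a ∈ P`. -/
def extensionDomain (T : Subgroup S) {P Q : Subgroup S} (φ : P →* Q) : Subgroup S where
  carrier := {y | y ∈ T ⊓ Subgroup.normalizer (P : Set S) ∧
    ∃ z ∈ T ⊓ Subgroup.normalizer (image φ : Set S),
      ∀ a b : P, (b : S) = y * a * y⁻¹ → (φ b : S) = z * φ a * z⁻¹}
  one_mem' := ⟨one_mem _, 1, one_mem _, fun a b h => by
    have : b = a := Subtype.ext (by simpa using h)
    simp [this]⟩
  mul_mem' := by
    rintro x y ⟨hx, z, hz, hzx⟩ ⟨hy, w, hw, hwy⟩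
    refine ⟨mul_mem hx hy, z * w, mul_mem hz hw, fun a b hab => ?_⟩
    have hm : y * a * y⁻¹ ∈ P := (Subgroup.mem_set_normalizer_iff.1 hy.2 a).1 a.2
    rw [hzx ⟨_, hm⟩ b (by rw [hab]; group), hwy a ⟨_, hm⟩ rfl]
    group
  inv_mem' := by
    rintro x ⟨hx, z, hz, hzx⟩
    refine ⟨inv_mem hx, z⁻¹, inv_mem hz, fun a b hab => ?_⟩
    rw [hzx b a (by rw [hab]; group)]
    group

/-- `F` is a saturated fusion system on `T`: `Aut_T(T)` is a Sylow `p`-subgroup of `Aut_F(T)`, and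
every morphism `φ : P → T` of `F` with fully `F`-normalized image extends to `N_φ`. -/
def IsSaturated (p : ℕ) (F : FusionSystem T) : Prop :=
  (∃ A : Sylow p F.autTop,
    (A : Subgroup F.autTop).map F.autTop.subtype = (MulAut.conj : T →* MulAut T).range) ∧
  ∀ (P : Subgroup S) (φ : P →* T), φ ∈ F.hom P T → F.IsFullyNormalized (image φ) →
    ∃ ψ ∈ F.hom (extensionDomain T φ) T,
      ∀ (x : P) (y : extensionDomain T φ), (y : S) = x → ψ y = φ x

/-- `F` is realizable: there is a finite group `G` containing `T` as a Sylow `p`-subgroup (via an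
embedding `i`) such that the morphisms of `F` are exactly the homomorphisms between subgroups of
`T` that are given by conjugation by an element of `G`. -/
def IsRealizable (p : ℕ) (F : FusionSystem T) : Prop :=
  ∃ (G : Type) (_ : Group G) (_ : Finite G) (i : T →* G), Function.Injective i ∧
    (∃ A : Sylow p G, (A : Subgroup G) = i.range) ∧
    ∀ (P Q : Subgroup S) (φ : P →* Q), φ ∈ F.hom P Q ↔
      ∃ (hP : P ≤ T) (hQ : Q ≤ T) (g : G), ∀ x : P,
        i (Subgroup.inclusion hQ (φ x)) = g * i (Subgroup.inclusion hP x) * g⁻¹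

end FusionSystem

/-! ### Orbit categories -/

/-- The full subcategory of the fusion system `F` on its objects belonging to `C`. -/
structure FusionCat {S : Type} [Group S] {T : Subgroup S} (F : FusionSystem T)
    (C : Set (Subgroup S)) where
  carrier : Subgroup S
  le : carrier ≤ T
  mem : carrier ∈ C

variable {S : Type} [Group S] {T T' U V : Subgroup S}

instance (F : FusionSystem T) (C : Set (Subgroup S)) : SmallCategory (FusionCat F C) where
  Hom P Q := {φ : P.carrier →* Q.carrier // φ ∈ F.hom P.carrier Q.carrier}
  id P := ⟨MonoidHom.id _, F.id_mem P.le⟩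
  comp φ ψ := ⟨ψ.1.comp φ.1, F.comp_mem φ.2 ψ.2⟩

/-- Two morphisms `P → Q` are related if they differ by an inner automorphism of `Q`. -/
def orbitRel (F : FusionSystem T) (C : Set (Subgroup S)) : HomRel (FusionCat F C) :=
  fun _ Q φ ψ => ∃ q : Q.carrier, ψ.1 = (MulAut.conj q).toMonoidHom.comp φ.1

instance (F : FusionSystem T) (C : Set (Subgroup S)) : Congruence (orbitRel F C) where
  equivalence := by
    intro P Q
    refine ⟨fun φ => ⟨1, by ext; simp⟩, ?_, ?_⟩
    · rintro φ ψ ⟨q, h⟩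
      exact ⟨q⁻¹, by rw [h]; ext; simp [mul_assoc]⟩
    · rintro φ ψ χ ⟨q, h⟩ ⟨r, h'⟩
      exact ⟨r * q, by rw [h', h]; ext; simp [mul_assoc]⟩
  comp_left := by
    rintro P Q R f φ ψ ⟨q, h⟩
    exact ⟨q, by change ψ.1.comp f.1 = _; rw [h]; rfl⟩
  comp_right := by
    rintro P Q R φ ψ f ⟨q, h⟩
    exact ⟨f.1 q, by change f.1.comp ψ.1 = (MulAut.conj _).toMonoidHom.comp (f.1.comp φ.1); rw [h]; ext; simp⟩

/-- The `C`-orbit category `O_C(F)`: its objects are the subgroups of `T` in `C`, its morphisms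
from `P` to `Q` are the orbits of `Aut_Q(Q)` on `Hom_F(P, Q)`, acting by postcomposition. -/
abbrev OrbitCat (F : FusionSystem T) (C : Set (Subgroup S)) : Type :=
  CategoryTheory.Quotient (orbitRel F C)

/-- The inclusion functor `O_C(H) ⥤ O_C(F)` for `H ⊆ F`. -/
def orbitIncl {H : FusionSystem T} {F : FusionSystem U} (h : H.Sub F) (C : Set (Subgroup S)) :
    OrbitCat H C ⥤ OrbitCat F C :=
  CategoryTheory.Quotient.lift (orbitRel H C)
    { obj := fun P => (CategoryTheory.Quotient.functor (orbitRel F C)).obj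
        ⟨P.carrier, P.le.trans h.le, P.mem⟩
      map := fun φ => (CategoryTheory.Quotient.functor (orbitRel F C)).map
        ⟨φ.1, h _ _ φ.2⟩ }
    (fun _ _ _ _ hr => CategoryTheory.Quotient.sound (orbitRel F C) hr)

/-! ### Modules over orbit categories -/

/-- Contravariant functors from `O_C(F)` to `𝔽_p`-modules. -/
abbrev OrbitMod (p : ℕ) (F : FusionSystem T) (C : Set (Subgroup S)) : Type 1 :=
  (OrbitCat F C)ᵒᵖ ⥤ ModuleCat.{0} (ZMod p)

/-- The constant functor with value `𝔽_p`. -/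
def constMod (p : ℕ) (F : FusionSystem T) (C : Set (Subgroup S)) : OrbitMod p F C :=
  (Functor.const _).obj (ModuleCat.of (ZMod p) (ZMod p))

section Induction

variable {H : FusionSystem T} {F : FusionSystem U} (p : ℕ) (C : Set (Subgroup S))

/-- Restriction of functors from `O_C(F)` to `O_C(H)`. -/
abbrev resMod (h : H.Sub F) : OrbitMod p F C ⥤ OrbitMod p H C :=
  (Functor.whiskeringLeft _ _ _).obj (orbitIncl h C).op

/-- Induction of functors from `O_C(H)` to `O_C(F)`, i.e. left Kan extension along the inclusion
(equivalently, the tensor product over the category algebra of `O_C(H)` with that of `O_C(F)`). -/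
abbrev indMod (h : H.Sub F) : OrbitMod p H C ⥤ OrbitMod p F C := (orbitIncl h C).op.lan

/-- Induction is left adjoint to restriction. -/
abbrev indResAdj (h : H.Sub F) : indMod p C h ⊣ resMod p C h :=
  (orbitIncl h C).op.lanAdjunction _

/-- The constant functor `𝔽_p` restricted to `O_C(H)` and induced back to `O_C(F)`. -/
abbrev constInd (h : H.Sub F) : OrbitMod p F C :=
  (indMod p C h).obj ((resMod p C h).obj (constMod p F C))

end Induction

/-- For `K ⊆ L ⊆ F` and `K ⊆ G ⊆ F`, the map of functors on `O_C(K)` that sends the constant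
functor to the restriction of `constInd` of `L ⊆ F`, namely `λ ↦ λ ⊗ id_P` at `P`. -/
def constToInd (p : ℕ) (C : Set (Subgroup S)) {K : FusionSystem T} {L : FusionSystem T'}
    {G : FusionSystem U} {F : FusionSystem V} (hKL : K.Sub L) (hLF : L.Sub F) (hKG : K.Sub G)
    (hGF : G.Sub F) :
    (resMod p C hKG).obj (constMod p G C) ⟶
      (resMod p C hKG).obj ((resMod p C hGF).obj (constInd p C hLF)) where
  app P := ((indResAdj p C hLF).unit.app ((resMod p C hLF).obj (constMod p F C))).app
    (Opposite.op ((orbitIncl hKL C).obj P.unop))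
  naturality := by
    intro P Q f
    obtain ⟨g, hg⟩ := (CategoryTheory.Quotient.functor (orbitRel K C)).map_surjective f.unop
    have hf : f = Quiver.Hom.op ((CategoryTheory.Quotient.functor (orbitRel K C)).map g) := by
      rw [hg]; rfl
    subst hf
    exact ((indResAdj p C hLF).unit.app ((resMod p C hLF).obj (constMod p F C))).naturality
      ((orbitIncl hKL C).map ((CategoryTheory.Quotient.functor _).map g)).op

/-- For `K ⊆ L ⊆ F` and `K ⊆ G ⊆ F`, the natural projection from the constant functor on `O_C(K)`
induced to `O_C(G)` and then to `O_C(F)` onto the constant functor on `O_C(L)` induced to `O_C(F)`;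
on elementary tensors it is given by `λ ⊗ φ ↦ λ ⊗ φ`. -/
def indProj (p : ℕ) (C : Set (Subgroup S)) {K : FusionSystem T} {L : FusionSystem T'}
    {G : FusionSystem U} {F : FusionSystem V} (hKL : K.Sub L) (hLF : L.Sub F) (hKG : K.Sub G)
    (hGF : G.Sub F) : (indMod p C hGF).obj (constInd p C hKG) ⟶ constInd p C hLF :=
  ((indResAdj p C hGF).homEquiv _ _).symm
    (((indResAdj p C hKG).homEquiv _ _).symm (constToInd p C hKL hLF hKG hGF))

/-! ### Cohomology as a functor on the orbit category -/

namespace GroupCohomologyConj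

variable (k : Type) [CommRing k] {G H : Type} [Group G] [Group H]

/-- The identity of `k`, as a map from the trivial `H`-module restricted along `f` to the trivial
`G`-module. -/
def trivRes (f : G →* H) : Rep.res f (Rep.trivial k H k) ⟶ Rep.trivial k G k :=
  Rep.ofHom ⟨LinearMap.id, fun _ => rfl⟩

variable (t : G)

lemma freeLift_apply {α : Type} (A : Rep k G) (f : α → A) (x : α) (g : G) (r : k) :
    (Rep.freeLift k G A f).hom (Finsupp.single x (MonoidAlgebra.single g r)) = r • A.ρ g (f x) :=
  Representation.freeLift_single_single A.ρ x g r f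

lemma conj_contractNth {n : ℕ} (j : Fin (n + 1)) (g : Fin (n + 1) → G) :
    (fun i => t * j.contractNth (· * ·) g i * t⁻¹) =
      j.contractNth (· * ·) (fun i => t * g i * t⁻¹) := by
  funext i
  simp only [Fin.contractNth]
  split_ifs <;> group

/-- The chain endomorphism of the bar resolution used to show that conjugation by `t` acts as the
identity on cohomology, in degree `n`. -/
def barConjF (n : ℕ) : Rep.free k G (Fin n → G) ⟶ Rep.free k G (Fin n → G) :=
  Rep.freeLift k G (Rep.free k G (Fin n → G)) fun g =>
    Finsupp.single (fun i => t * g i * t⁻¹) (MonoidAlgebra.single t⁻¹ 1)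

lemma barConjF_apply (n : ℕ) (g : Fin n → G) (a : G) (r : k) :
    (barConjF k t n).hom (Finsupp.single g (MonoidAlgebra.single a r)) =
      Finsupp.single (fun i => t * g i * t⁻¹) (MonoidAlgebra.single (a * t⁻¹) r) := by
  rw [barConjF, freeLift_apply]
  simp

lemma bar_d_apply (n : ℕ) (g : Fin (n + 1) → G) (a : G) :
    (Rep.barComplex.d k G n).hom (Finsupp.single g (MonoidAlgebra.single a 1)) =
      Finsupp.single (fun i => g i.succ) (MonoidAlgebra.single (a * g 0) 1) +
        ∑ j : Fin (n + 1), Finsupp.single (j.contractNth (· * ·) g)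
          (MonoidAlgebra.single a ((-1 : k) ^ (j.val + 1))) := by
  rw [Rep.barComplex.d, freeLift_apply]
  simp

def barConj : Rep.barComplex k G ⟶ Rep.barComplex k G where
  f n := barConjF k t n
  comm' i j hij := by
    obtain rfl : j + 1 = i := hij
    rw [Rep.barComplex.d_def]
    refine Rep.free_ext k G _ _ _ fun g => ?_
    change (Rep.barComplex.d k G j).hom ((barConjF k t (j + 1)).hom _) =
      (barConjF k t j).hom ((Rep.barComplex.d k G j).hom _)
    rw [bar_d_apply, barConjF_apply, bar_d_apply, map_add, map_sum, barConjF_apply]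
    congr 1
    · simp [mul_assoc]
    · refine Finset.sum_congr rfl fun x _ => ?_
      rw [barConjF_apply, conj_contractNth, one_mul]

lemma barConjF_zero_comp (φ : Rep.free k G (Fin 0 → G) ⟶ Rep.trivial k G k) :
    barConjF k t 0 ≫ φ = φ := by
  obtain ⟨f, rfl⟩ := (Rep.freeLiftLEquiv k G (Fin 0 → G) (Rep.trivial k G k)).symm.surjective φ
  refine Rep.free_ext k G _ _ _ fun g => ?_
  change (Rep.freeLift k G (Rep.trivial k G k) f).hom ((barConjF k t 0).hom _) =
    (Rep.freeLift k G (Rep.trivial k G k) f).hom _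
  rw [barConjF_apply, freeLift_apply, freeLift_apply, Subsingleton.elim (fun i => t * g i * t⁻¹) g]
  rfl

lemma barConj_π : barConj k t ≫ (Rep.barResolution k G).π = (Rep.barResolution k G).π := by
  apply HomologicalComplex.to_single_hom_ext
  exact barConjF_zero_comp k t ((Rep.barResolution k G).π.f 0)

def barHtpy : Homotopy (barConj k t) (𝟙 (Rep.barComplex k G)) :=
  ProjectiveResolution.liftHomotopy (𝟙 _) (P := Rep.barResolution k G) (Q := Rep.barResolution k G)
    _ _ (by rw [CategoryTheory.Functor.map_id, Category.comp_id]; exact barConj_π k t) (by rw [CategoryTheory.Functor.map_id, Category.comp_id]; exact Category.id_comp _)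

def yonedaMap {P Q : ChainComplex (Rep k G) ℕ} (f : P ⟶ Q) (A : Rep k G) :
    Q.linearYonedaObj k A ⟶ P.linearYonedaObj k A :=
  (HomologicalComplex.unopFunctor _ _).map
    ((((linearYoneda k (Rep k G)).obj A).rightOp.mapHomologicalComplex _).map f).op

lemma yonedaMap_apply {P Q : ChainComplex (Rep k G) ℕ} (f : P ⟶ Q) (A : Rep k G) (i : ℕ)
    (φ : Q.X i ⟶ A) : ((yonedaMap k f A).f i).hom φ = f.f i ≫ φ := rfl

lemma iso_apply (A : Rep k G) (i : ℕ) (f : (Fin i → G) → A) :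
    ((groupCohomology.inhomogeneousCochainsIso A).hom.f i).hom f = Rep.freeLift k G A f := rfl

lemma cochainsMap_apply (f : G →* H) (i : ℕ) (x : (Fin i → H) → k) :
    ((groupCohomology.cochainsMap f (trivRes k f)).f i).hom x = fun g => x (f ∘ g) := rfl

lemma barConjF_comp (i : ℕ) (f : (Fin i → G) → k) :
    barConjF k t i ≫ Rep.freeLift k G (Rep.trivial k G k) f =
      Rep.freeLift k G (Rep.trivial k G k) (fun x => f (fun i => t * x i * t⁻¹)) := by
  refine Rep.free_ext k G _ _ _ fun g => ?_
  change (Rep.freeLift k G (Rep.trivial k G k) f).hom ((barConjF k t i).hom _) = _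
  rw [barConjF_apply, freeLift_apply, freeLift_apply]
  rfl

lemma cochainsMap_conj :
    groupCohomology.cochainsMap (MulAut.conj t).toMonoidHom
        (trivRes k (MulAut.conj t).toMonoidHom) ≫
      (groupCohomology.inhomogeneousCochainsIso (Rep.trivial k G k)).hom =
    (groupCohomology.inhomogeneousCochainsIso (Rep.trivial k G k)).hom ≫
      yonedaMap k (barConj k t) (Rep.trivial k G k) := by
  refine HomologicalComplex.Hom.ext (funext fun i => ModuleCat.hom_ext (LinearMap.ext fun f => ?_))
  exact (barConjF_comp k t i f).symm

lemma map_conj (n : ℕ) :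
    groupCohomology.map (MulAut.conj t).toMonoidHom (trivRes k (MulAut.conj t).toMonoidHom) n = 𝟙 _ := by
  have h := (((((linearYoneda k (Rep k G)).obj (Rep.trivial k G k)).rightOp).mapHomotopy (barHtpy k t)).unop)
  have h2 : HomologicalComplex.homologyMap (yonedaMap k (barConj k t) (Rep.trivial k G k)) n = 𝟙 _ := by
    refine (h.homologyMap_eq n).trans ?_
    rw [CategoryTheory.Functor.map_id, op_id, CategoryTheory.Functor.map_id, HomologicalComplex.homologyMap_id]
    rfl
  have e := congrArg (fun f => HomologicalComplex.homologyMap f n) (cochainsMap_conj k t)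
  simp only [HomologicalComplex.homologyMap_comp, h2, Category.comp_id] at e
  exact (cancel_mono (HomologicalComplex.homologyMap
    (groupCohomology.inhomogeneousCochainsIso (Rep.trivial k G k)).hom n)).1
    (e.trans (Category.id_comp _).symm)
end GroupCohomologyConj

open GroupCohomologyConj in
/-- The contravariant functor `P ↦ H^j(P; 𝔽_p)` on the objects of `F` in `C`. -/
def cohomologyFusion (p : ℕ) (F : FusionSystem T) (C : Set (Subgroup S)) (j : ℕ) :
    FusionCat F C ⥤ (ModuleCat.{0} (ZMod p))ᵒᵖ where
  obj P := Opposite.op (groupCohomology (Rep.trivial (ZMod p) P.carrier (ZMod p)) j)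
  map φ := (groupCohomology.map φ.1 (trivRes (ZMod p) φ.1) j).op
  map_id _ := congrArg Quiver.Hom.op (groupCohomology.map_id j)
  map_comp φ ψ := congrArg Quiver.Hom.op
    (groupCohomology.map_comp ψ.1 φ.1 (trivRes (ZMod p) ψ.1) (trivRes (ZMod p) φ.1) j)

open GroupCohomologyConj in
/-- The functor `H^j(-; 𝔽_p)` on the orbit category `O_C(F)`. -/
def cohomologyMod (p : ℕ) (F : FusionSystem T) (C : Set (Subgroup S)) (j : ℕ) : OrbitMod p F C :=
  (CategoryTheory.Quotient.lift (orbitRel F C) (cohomologyFusion p F C j) (by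
    rintro P Q φ ψ ⟨q, h⟩
    refine congrArg Quiver.Hom.op ?_
    have h1 : groupCohomology.map ψ.1 (trivRes (ZMod p) ψ.1) j =
        groupCohomology.map ((MulAut.conj q).toMonoidHom.comp φ.1)
          (trivRes (ZMod p) ((MulAut.conj q).toMonoidHom.comp φ.1)) j := by rw [h]
    have h2 := groupCohomology.map_comp (MulAut.conj q).toMonoidHom φ.1
      (trivRes (ZMod p) (MulAut.conj q).toMonoidHom) (trivRes (ZMod p) φ.1) j
    rw [map_conj, Category.id_comp] at h2
    exact (h1.trans h2).symm)).leftOp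

/-! ### The tree of two fusion systems and its normalizer version -/

section Tree

/-- `F = ⟨F₁, F₂⟩_S` for `F₁` over `S` and `F₂` over a subgroup of `S`. -/
def amalgam (F₁ : FusionSystem (⊤ : Subgroup S)) (F₂ : FusionSystem T) :
    FusionSystem (⊤ : Subgroup S) := F₁.gen F₂ le_top

/-- `G = ⟨N_{F₁}(Q), N_{F₂}(Q)⟩` over `N_S(Q)`, for `F₁` over `S` and `F₂` over `T ≤ S` with
`Q ≤ T`. -/
def normAmalgam (F₁ : FusionSystem (⊤ : Subgroup S)) (F₂ : FusionSystem T) {Q : Subgroup S}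
    (hQ : Q ≤ T) : FusionSystem ((⊤ : Subgroup S) ⊓ Subgroup.normalizer (Q : Set S)) :=
  (F₁.normalizer Q le_top).gen (F₂.normalizer Q hQ) (inf_le_inf_right _ le_top)

variable {F₁ : FusionSystem (⊤ : Subgroup S)} {F₂ F₀ : FusionSystem T} {Q : Subgroup S}

lemma sub_amalgam (h₁ : F₀.Sub F₁) : F₀.Sub (amalgam F₁ F₂) :=
  h₁.trans (F₁.sub_gen_left F₂ le_top)

lemma normAmalgam_sub (hQ : Q ≤ T) : (normAmalgam F₁ F₂ hQ).Sub (amalgam F₁ F₂) :=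
  (FusionSystem.gen_sub _ _ _ ((amalgam F₁ F₂).normalizer Q le_top)
    ((F₁.sub_gen_left F₂ le_top).normalizer le_top le_top)
    ((F₁.sub_gen_right F₂ le_top).normalizer hQ le_top)).trans (FusionSystem.normalizer_sub _ _ _)

lemma normalizer_sub_normAmalgam (h₁ : F₀.Sub F₁) (hQ : Q ≤ T) :
    (F₀.normalizer Q hQ).Sub (normAmalgam F₁ F₂ hQ) :=
  (h₁.normalizer hQ le_top).trans (FusionSystem.sub_gen_left _ _ _)

variable (p : ℕ) (C : Set (Subgroup S)) (F₂)

/-- `CX₁`: the constant functor `𝔽_p` on `O_C(F₀)` induced to `O_C(F)`, where `F = ⟨F₁, F₂⟩_S`. -/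
abbrev CX₁ (h₁ : F₀.Sub F₁) : OrbitMod p (amalgam F₁ F₂) C :=
  constInd p C (sub_amalgam (F₂ := F₂) h₁)

/-- `CY₁`: the constant functor `𝔽_p` on `O_C(N_{F₀}(Q))` induced to `O_C(G)`, where
`G = ⟨N_{F₁}(Q), N_{F₂}(Q)⟩`. -/
abbrev CY₁ (h₁ : F₀.Sub F₁) (hQ : Q ≤ T) : OrbitMod p (normAmalgam F₁ F₂ hQ) C :=
  constInd p C (normalizer_sub_normAmalgam (F₂ := F₂) h₁ hQ)

/-- `CY₁` induced further from `O_C(G)` to `O_C(F)`. -/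
abbrev CY₁Ind (h₁ : F₀.Sub F₁) (hQ : Q ≤ T) : OrbitMod p (amalgam F₁ F₂) C :=
  (indMod p C (normAmalgam_sub hQ)).obj (CY₁ F₂ p C h₁ hQ)

/-- The natural projection `π₁` from the induced functor `CY₁` to `CX₁`, arising from the inclusion
`N_{F₀}(Q) ⊆ F₀`. -/
abbrev π₁ (h₁ : F₀.Sub F₁) (hQ : Q ≤ T) : CY₁Ind F₂ p C h₁ hQ ⟶ CX₁ F₂ p C h₁ :=
  indProj p C (F₀.normalizer_sub Q hQ) (sub_amalgam h₁) (normalizer_sub_normAmalgam h₁ hQ)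
    (normAmalgam_sub hQ)

/-- The linear map `π₁^* : Nat(CX₁, M) → Nat(CY₁ induced, M)` given by precomposition with `π₁`. -/
def π₁Star (h₁ : F₀.Sub F₁) (hQ : Q ≤ T) (M : OrbitMod p (amalgam F₁ F₂) C) :
    (CX₁ F₂ p C h₁ ⟶ M) →ₗ[ZMod p] (CY₁Ind F₂ p C h₁ hQ ⟶ M) :=
  Linear.leftComp (ZMod p) M (π₁ F₂ p C h₁ hQ)

end Tree

end

/-!
By the adjunction between induction and restriction, natural transformations out of a constant
functor induced from `O_C(L)` to `O_C(F)` are compatible families indexed by the objects of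
`O_C(L)`, that is, elements of the limit of `M` over `O_C(L)`. When the group `T'` underlying `L`
belongs to `C`, such a family is determined by its member at `T'`, because every object of `O_C(L)`
includes into `T'` (`constInd_hom_ext`). Hence, if the subsystem `K ⊆ L` lives over the same group
`T'`, a family is already determined by its restriction to `O_C(K)`, which means that the natural
projection from the functor induced from `K` onto the functor induced from `L` is an epimorphism
(`epi_indProj`).

As `Q` is normal in `S'`, the fusion systems `N_{Fₑ}(Q)` and `Fₑ` are both over `S'`, and `S' ∈ C`
since `Q ≤ S'`. So `π₁` is an epimorphism, and precomposition with it is injective. An injective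
linear map of vector spaces over the field `𝔽_p` has a linear left inverse.
-/

section

variable {S : Type} [Group S] {T T' U V : Subgroup S} (p : ℕ) {C : Set (Subgroup S)}

/-- Two morphisms out of the constant functor induced from `O_C(L)`, with `L` over `T' ∈ C`, agree
as soon as they agree on the elementary tensors `λ ⊗ id` at `T'`. -/
lemma constInd_hom_ext {L : FusionSystem T'} {F : FusionSystem V} (hLF : L.Sub F) (hT' : T' ∈ C)
    {M : OrbitMod p F C} {f g : constInd p C hLF ⟶ M}
    (h : (((indResAdj p C hLF).homEquiv _ _) f).app
        (Opposite.op ((CategoryTheory.Quotient.functor (orbitRel L C)).obj ⟨T', le_rfl, hT'⟩)) =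
      (((indResAdj p C hLF).homEquiv _ _) g).app
        (Opposite.op ((CategoryTheory.Quotient.functor (orbitRel L C)).obj ⟨T', le_rfl, hT'⟩))) :
    f = g := by
  apply ((indResAdj p C hLF).homEquiv _ _).injective
  refine NatTrans.ext (funext fun P => ?_)
  let ι : P.unop ⟶ (CategoryTheory.Quotient.functor (orbitRel L C)).obj ⟨T', le_rfl, hT'⟩ :=
    (CategoryTheory.Quotient.functor (orbitRel L C)).map
      (X := P.unop.as) (Y := ⟨T', le_rfl, hT'⟩)
      ⟨Subgroup.inclusion P.unop.as.le, L.inclusion_mem _ le_rfl⟩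
  have nat (u : (resMod p C hLF).obj (constMod p F C) ⟶ (resMod p C hLF).obj M) :
      u.app P = u.app (Opposite.op _) ≫ ((resMod p C hLF).obj M).map ι.op :=
    -- The constant functor sends `ι` to an identity.
    (Category.id_comp _).symm.trans (u.naturality ι.op)
  rw [nat, nat, h]

/-- For `K ⊆ L` over the same group `T' ∈ C`, the natural projection between the induced constant
functors is an epimorphism. -/
lemma epi_indProj {K : FusionSystem T} {L : FusionSystem T'} {G : FusionSystem U}
    {F : FusionSystem V} (hKL : K.Sub L) (hLF : L.Sub F) (hKG : K.Sub G) (hGF : G.Sub F)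
    (hT : T = T') (hT' : T' ∈ C) : Epi (indProj p C hKL hLF hKG hGF) := by
  subst hT
  refine ⟨fun {M} f g hfg => constInd_hom_ext p hLF hT' ?_⟩
  have h : constToInd p C hKL hLF hKG hGF ≫ (resMod p C hKG).map ((resMod p C hGF).map f) =
      constToInd p C hKL hLF hKG hGF ≫ (resMod p C hKG).map ((resMod p C hGF).map g) := by
    apply ((indResAdj p C hKG).homEquiv _ _).symm.injective
    rw [Adjunction.homEquiv_naturality_right_symm, Adjunction.homEquiv_naturality_right_symm]
    apply ((indResAdj p C hGF).homEquiv _ _).symm.injective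
    rw [Adjunction.homEquiv_naturality_right_symm, Adjunction.homEquiv_naturality_right_symm]
    exact hfg
  rw [Adjunction.homEquiv_unit, Adjunction.homEquiv_unit]
  exact congrArg (fun u => NatTrans.app u (Opposite.op
    ((CategoryTheory.Quotient.functor (orbitRel K C)).obj ⟨T, le_rfl, hT'⟩))) h

end

theorem mainTheorem8 (p : ℕ) [Fact p.Prime] {S : Type} [Group S] [Finite S] (hS : IsPGroup p S)
    (S' : Subgroup S) (F₁ : FusionSystem (⊤ : Subgroup S)) (F₂ Fₑ : FusionSystem S')
    (h₁ : Fₑ.Sub F₁) (h₂ : Fₑ.Sub F₂)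
    (hsat : (amalgam F₁ F₂).IsSaturated p) (hsat₁ : F₁.IsSaturated p)
    (hsat₂ : F₂.IsSaturated p) (hsatₑ : Fₑ.IsSaturated p)
    (C : Set (Subgroup S))
    (hCcentric : ∀ P ∈ C, (amalgam F₁ F₂).IsCentric P)
    (hCconj : ∀ P ∈ C, ∀ R, (amalgam F₁ F₂).IsConj P R → R ∈ C)
    (hCover : ∀ P ∈ C, ∀ R, P ≤ R → R ∈ C)
    (Q : Subgroup S) (hQS' : Q ≤ S') (hQC : Q ∈ C)
    (hQnorm : (amalgam F₁ F₂).IsFullyNormalized Q)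
    (hreal : Fₑ.IsRealizable p) (hnormal : (Q.subgroupOf S').Normal) (j : ℕ) :
    ∃ ξ : (CY₁Ind F₂ p C h₁ hQS' ⟶ cohomologyMod p (amalgam F₁ F₂) C j) →ₗ[ZMod p]
        (CX₁ F₂ p C h₁ ⟶ cohomologyMod p (amalgam F₁ F₂) C j),
      ξ ∘ₗ π₁Star F₂ p C h₁ hQS' (cohomologyMod p (amalgam F₁ F₂) C j) = LinearMap.id := by
  have hbase : (S' ⊓ Subgroup.normalizer (Q : Set S) : Subgroup S) = S' :=
    inf_eq_left.2 ((Subgroup.normal_subgroupOf_iff_le_normalizer hQS').1 hnormal)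
  have : Epi (π₁ F₂ p C h₁ hQS') :=
    epi_indProj p _ _ _ _ hbase (hCover Q hQC S' hQS')
  refine LinearMap.exists_leftInverse_of_injective _ (LinearMap.ker_eq_bot.2 fun f g hfg => ?_)
  exact (cancel_epi (π₁ F₂ p C h₁ hQS')).1 hfg
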